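/- For $n\ge 0$ let $\mathfrak S_n$ be the set of permutations of $[n]=\{1,\dots,n\}$, and let $\mathcal B_n$ be the set of permutations $\sigma$ of $\{\pm1,\dots,\pm n\}$ with $\sigma(-i)=-\sigma(i)$ for all $i$; for $\sigma\in\mathcal B_n$ put $\sigma(0)=0$. A position $i$ is an alternating descent of $\sigma$ if either $i$ is odd and $\sigma(i)>\sigma(i+1)$, or $i$ is even and $\sigma(i)<\sigma(i+1)$. Let $\hat d(\sigma)$ be the number of alternating descents $i\in\{1,\dots,n-1\}$ of $\sigma\in\mathfrak S_n$, let $\hat d_B(\sigma)$ be the number of alternating descents $i\in\{0,1,\dots,n-1\}$ of $\sigma\in\mathcal B_n$, and set $$\hat A_n(x)=\sum_{\sigma\in\mathfrak S_n}x^{\hat d(\sigma)},\qquad \hat B_n(x)=\sum_{\sigma\in\mathcal B_n}x^{\hat d_B(\sigma)}.$$ Let $K$ be a field of characteristic $0$ and let $x\in K$ with $x\neq1$ (for example, $K=\mathbb Q(x)$ with $x$ an indeterminate). Then, as formal power series in $z$ over $K$, $$\sum_{n\ge1}\hat A_n(x)\frac{z^n}{n!}=\frac{\sec((1-x)z)+\tan((1-x)z)-1}{1-x\bigl(\sec((1-x)z)+\tan((1-x)z)\bigr)},$$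 $$\sum_{n\ge0}\hat B_n(x)\frac{z^n}{n!}=\frac{x-1}{(x-1)\cos(z(1-x))+(x+1)\sin(z(1-x))}.$$ -/

import Mathlib

/-- The word `w` has an alternating descent at position `i`: either `w i > w (i+1)` and `i` is odd,
or `w i < w (i+1)` and `i` is even. -/
def IsAltDescent (w : ℕ → ℤ) (i : ℕ) : Prop :=
  (w i > w (i + 1) ∧ Odd i) ∨ (w i < w (i + 1) ∧ Even i)

instance (w : ℕ → ℤ) : DecidablePred (IsAltDescent w) := fun i => by
  unfold IsAltDescent; infer_instance

/-- The one-line word of a permutation `σ` of `[n] = {1, …, n}`, indexed by the positions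
`1, …, n`; here `Fin n` stands for `[n]` through `j ↦ j + 1`. Other positions are never read. -/
def wordA {n : ℕ} (σ : Equiv.Perm (Fin n)) (i : ℕ) : ℤ :=
  if h : 1 ≤ i ∧ i ≤ n then (σ ⟨i - 1, by omega⟩ : ℕ) + 1 else 0

/-- The set of alternating descent positions `i ∈ [n-1]` of `σ ∈ 𝔖ₙ`. -/
def altDescentsA {n : ℕ} (σ : Equiv.Perm (Fin n)) : Finset ℕ :=
  (Finset.Ico 1 n).filter (IsAltDescent (wordA σ))

/-- The alternating Eulerian polynomial of type A. -/
noncomputable def altEulerianA (n : ℕ) : Polynomial ℤ :=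
  ∑ σ : Equiv.Perm (Fin n), Polynomial.X ^ (altDescentsA σ).card

/-- The set `[±n] = {1, …, n} ∪ {-1, …, -n}`. -/
abbrev PlusMinus (n : ℕ) : Type := {j : ℤ // j ∈ (Finset.Icc (-(n : ℤ)) n).erase 0}

/-- Permutations of type B: the permutations `σ` of `[±n]` with `σ(-i) = -σ(i)`. -/
abbrev SignedPerm (n : ℕ) : Type :=
  {σ : Equiv.Perm (PlusMinus n) //
    ∀ i j : PlusMinus n, (j : ℤ) = -(i : ℤ) → (σ j : ℤ) = -(σ i : ℤ)}

/-- The word `σ(0) σ(1) ⋯ σ(n)` of a type B permutation, with `σ(0) = 0`.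
Positions larger than `n` are never read. -/
noncomputable def wordB {n : ℕ} (σ : SignedPerm n) (i : ℕ) : ℤ :=
  if h : (i : ℤ) ∈ (Finset.Icc (-(n : ℤ)) n).erase 0 then (σ.1 ⟨i, h⟩ : ℤ) else 0

/-- The set of alternating descent positions `i ∈ {0} ∪ [n-1]` of a type B permutation. -/
noncomputable def altDescentsB {n : ℕ} (σ : SignedPerm n) : Finset ℕ :=
  (Finset.range n).filter (IsAltDescent (wordB σ))

/-- The alternating Eulerian polynomial of type B. -/
noncomputable def altEulerianB (n : ℕ) : Polynomial ℤ :=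
  ∑ σ : SignedPerm n, Polynomial.X ^ (altDescentsB σ).card

section Series

variable (K : Type*) [Field K] [CharZero K]

/-- The formal power series of the secant. -/
noncomputable def secSeries : PowerSeries K := (PowerSeries.cos K)⁻¹

/-- The formal power series of the tangent. -/
noncomputable def tanSeries : PowerSeries K := PowerSeries.sin K * (PowerSeries.cos K)⁻¹

theorem constantCoeff_cos_eq : PowerSeries.constantCoeff (PowerSeries.cos K) = 1 := by
  rw [← PowerSeries.coeff_zero_eq_constantCoeff_apply, PowerSeries.cos, PowerSeries.coeff_mk]
  simp

theorem constantCoeff_sin_eq : PowerSeries.constantCoeff (PowerSeries.sin K) = 0 := by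
  rw [← PowerSeries.coeff_zero_eq_constantCoeff_apply, PowerSeries.sin, PowerSeries.coeff_mk]
  simp

/-- The inverse of the cosine series is a genuine one. -/
theorem cos_mul_secSeries : PowerSeries.cos K * secSeries K = 1 :=
  PowerSeries.mul_inv_cancel _ (by simp [constantCoeff_cos_eq])

variable {K}

/-- `sec((1-x)z) + tan((1-x)z)` as a formal power series in `z`. -/
noncomputable def secTan (x : K) : PowerSeries K :=
  PowerSeries.rescale (1 - x) (secSeries K) + PowerSeries.rescale (1 - x) (tanSeries K)

/-- The denominator `1 - x (sec((1-x)z) + tan((1-x)z))` of the type A formula. -/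
noncomputable def denomA (x : K) : PowerSeries K := 1 - PowerSeries.C x * secTan x

/-- The denominator `(x-1) cos(z(1-x)) + (x+1) sin(z(1-x))` of the type B formula. -/
noncomputable def denomB (x : K) : PowerSeries K :=
  PowerSeries.C (x - 1) * PowerSeries.rescale (1 - x) (PowerSeries.cos K) +
    PowerSeries.C (x + 1) * PowerSeries.rescale (1 - x) (PowerSeries.sin K)

theorem constantCoeff_rescale_eq {R : Type*} [CommRing R] (a : R) (f : PowerSeries R) :
    PowerSeries.constantCoeff (PowerSeries.rescale a f) = PowerSeries.constantCoeff f := by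
  rw [← PowerSeries.coeff_zero_eq_constantCoeff_apply, PowerSeries.coeff_rescale]
  simp

/-- The inverse of `denomA x` is a genuine one for `x ≠ 1`. -/
theorem denomA_mul_inv (x : K) (hx : x ≠ 1) : denomA x * (denomA x)⁻¹ = 1 := by
  apply PowerSeries.mul_inv_cancel
  have h : (1 : K) - x ≠ 0 := sub_ne_zero.mpr hx.symm
  simpa [denomA, secTan, secSeries, tanSeries, constantCoeff_rescale_eq, constantCoeff_cos_eq,
    constantCoeff_sin_eq] using h

/-- The inverse of `denomB x` is a genuine one for `x ≠ 1`. -/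
theorem denomB_mul_inv (x : K) (hx : x ≠ 1) : denomB x * (denomB x)⁻¹ = 1 := by
  apply PowerSeries.mul_inv_cancel
  have h : x - 1 ≠ 0 := sub_ne_zero.mpr hx
  simpa [denomB, constantCoeff_rescale_eq, constantCoeff_cos_eq,
    constantCoeff_sin_eq] using h

end Series

/-!
Put a letter in front of a permutation. Its weight, as a function of the number `k` of letters that
the new letter exceeds, changes from `k` to `k + 1` only for the permutations that start with the
letter just passed, and then by `± (1 - x)` times the weight of the permutation. Hence the total
weights obey the recurrence of the Seidel–Entringer–Arnold triangle, and Newton's forward difference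
formula expresses the exponential generating function at `k = n` through those at `k = 0`, with
coefficients `cos ((1 - x) z)` and `sin ((1 - x) z)`. Reversing the order of the alphabet exchanges
the parities of the positions; this closes the system to one linear equation. Types A and B are the
permutations with signs in the trivial subgroup and in the whole of `{1, -1}`.
-/

section StepWeight

variable {R : Type*} [One R]

/-- The weight of a descent at position `i`, namely `x` for odd `i` and `1` for even `i`. The weight
of an ascent at position `i` is `descentWeight x (i + 1)`. -/
def descentWeight (x : R) (i : ℕ) : R := if Even i then 1 else x

theorem descentWeight_add_two (x : R) (i : ℕ) :
    descentWeight x (i + 2) = descentWeight x i := by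
  simp [descentWeight, Nat.even_add]

theorem descentWeight_eq_add {R : Type*} [CommRing R] (x : R) (i : ℕ) :
    descentWeight x i = descentWeight x (i + 1) + (-1) ^ i * (1 - x) := by
  rcases Nat.even_or_odd i with h | h
  · simp [descentWeight, h, h.neg_one_pow, Nat.even_add_one]
  · simp [descentWeight, Nat.not_even_iff_odd.mpr h, h.neg_one_pow, Nat.even_add_one]

/-- The contribution to `x ^ (number of alternating descents)` of the adjacent letters `a`, `b` at
the positions `i`, `i + 1`. Equal letters count as an ascent. -/
def stepWeight {α : Type*} [LinearOrder α] (x : R) (i : ℕ) (a b : α) : R :=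
  if b < a then descentWeight x i else descentWeight x (i + 1)

theorem ite_isAltDescent_eq_stepWeight (x : R) {w : ℕ → ℤ} {i : ℕ} (h : w i ≠ w (i + 1)) :
    (if IsAltDescent w i then x else 1) = stepWeight x i (w i) (w (i + 1)) := by
  rcases h.lt_or_gt with h | h <;> by_cases hi : Even i <;>
    simp [IsAltDescent, stepWeight, descentWeight, h, h.not_gt, hi, Nat.even_add_one,
      ← Nat.not_even_iff_odd]

end StepWeight

section WordWeight

variable {R : Type*} [CommMonoid R] (x : R) {α β : Type*} [LinearOrder α] [LinearOrder β]

/-- The weight `x ^ (number of alternating descents)` of a word whose first letter is at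
position `i`. -/
def wordWeight {n : ℕ} (i : ℕ) (w : Fin (n + 1) → α) : R :=
  ∏ j : Fin n, stepWeight x (i + j) (w j.castSucc) (w j.succ)

theorem pow_card_filter_isAltDescent {n m : ℕ} {u : ℕ → ℤ} {w : Fin (n + 1) → ℤ}
    (hu : ∀ j : Fin (n + 1), u (m + j) = w j) (hw : Function.Injective w) :
    x ^ ((Finset.Ico m (m + n)).filter (IsAltDescent u)).card = wordWeight x m w := by
  have hstep (j : Fin n) : (if IsAltDescent u (m + j) then x else 1) =
      stepWeight x (m + j) (w j.castSucc) (w j.succ) := by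
    have hcast : u (m + j) = w j.castSucc := hu j.castSucc
    have hsucc : u (m + j + 1) = w j.succ := hu j.succ
    have hne : w j.castSucc ≠ w j.succ := hw.ne Fin.castSucc_lt_succ.ne
    rw [ite_isAltDescent_eq_stepWeight x (by rwa [hcast, hsucc]), hcast, hsucc]
  rw [← Finset.prod_const, Finset.prod_filter, Finset.prod_Ico_eq_prod_range,
    Nat.add_sub_cancel_left,
    ← Fin.prod_univ_eq_prod_range (fun j => if IsAltDescent u (m + j) then x else 1)]
  exact Finset.prod_congr rfl fun j _ => hstep j

theorem wordWeight_cons {n : ℕ} (i : ℕ) (a : α) (w : Fin (n + 1) → α) :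
    wordWeight x i (Fin.cons a w : Fin (n + 2) → α) =
      stepWeight x i a (w 0) * wordWeight x (i + 1) w := by
  simp [wordWeight, Fin.prod_univ_succ, add_assoc, add_comm 1]

theorem wordWeight_add_two {n : ℕ} (i : ℕ) (w : Fin (n + 1) → α) :
    wordWeight x (i + 2) w = wordWeight x i w := by
  refine Finset.prod_congr rfl fun j _ => ?_
  simp only [stepWeight, add_right_comm _ 2, descentWeight_add_two]

theorem wordWeight_comp_strictMono {n : ℕ} (i : ℕ) {φ : α → β} (hφ : StrictMono φ)
    (w : Fin (n + 1) → α) : wordWeight x i (φ ∘ w) = wordWeight x i w := by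
  simp [wordWeight, stepWeight, hφ.lt_iff_lt]

theorem wordWeight_comp_strictAnti {n : ℕ} (i : ℕ) {φ : α → β} (hφ : StrictAnti φ)
    {w : Fin (n + 1) → α} (hw : Function.Injective w) :
    wordWeight x (i + 1) (φ ∘ w) = wordWeight x i w := by
  refine Finset.prod_congr rfl fun j _ => ?_
  have hne : w j.castSucc ≠ w j.succ := hw.ne Fin.castSucc_lt_succ.ne
  rw [add_right_comm]
  rcases hne.lt_or_gt with h | h
  · simp [stepWeight, hφ.lt_iff_gt, h, h.not_gt]
  · simp [stepWeight, hφ.lt_iff_gt, h, h.not_gt, descentWeight_add_two]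

end WordWeight

section Standardization

variable {n : ℕ}

/-- The permutation of `Fin (n + 1)` whose one-line word starts with `k` and continues with the word
of `τ`, its letters renumbered so as to avoid `k`. -/
def consPerm (k : Fin (n + 1)) (τ : Equiv.Perm (Fin n)) : Equiv.Perm (Fin (n + 1)) :=
  k.cycleRange⁻¹ * Equiv.Perm.decomposeFin.symm (0, τ)

theorem consPerm_zero (k : Fin (n + 1)) (τ : Equiv.Perm (Fin n)) : consPerm k τ 0 = k := by
  simp [consPerm]

theorem consPerm_succ (k : Fin (n + 1)) (τ : Equiv.Perm (Fin n)) (j : Fin n) :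
    consPerm k τ j.succ = k.succAbove (τ j) := by
  simp [consPerm]

variable {M : Type*} [AddCommMonoid M]

theorem sum_perm_ite_apply_zero (k : Fin (n + 1)) (F : Equiv.Perm (Fin (n + 1)) → M) :
    ∑ σ, (if σ 0 = k then F σ else 0) = ∑ τ, F (consPerm k τ) := by
  rw [← Equiv.sum_comp (Equiv.mulLeft k.cycleRange⁻¹),
    ← Equiv.sum_comp Equiv.Perm.decomposeFin.symm, Fintype.sum_prod_type]
  have hzero (p : Fin (n + 1)) : k.cycleRange.symm p = k ↔ p = 0 := by
    rw [Equiv.symm_apply_eq, Fin.cycleRange_self]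
  simp [hzero, consPerm]

theorem sum_fun_ite_apply_zero {ι : Type*} [Fintype ι] [DecidableEq ι] (a : ι)
    (F : (Fin (n + 1) → ι) → M) :
    ∑ f, (if f 0 = a then F f else 0) = ∑ g : Fin n → ι, F (Fin.cons a g) := by
  rw [← Equiv.sum_comp (Fin.consEquiv fun _ => ι), Fintype.sum_prod_type]
  simp [Fin.consEquiv]

end Standardization

section SignedWords

variable {n : ℕ} {S : Subgroup ℤˣ}

/-- The word of a permutation `σ` with signs `ε` taken in `S`. The letter `± (a + 1)` is encoded as
`± (2 * a + 1)`, so that the even numbers `2 * k` separate the letters. -/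
def signedWord (σ : Equiv.Perm (Fin n)) (ε : Fin n → S) (j : Fin n) : ℤ :=
  (ε j : ℤˣ) * (2 * (σ j : ℕ) + 1)

theorem odd_signedWord (σ : Equiv.Perm (Fin n)) (ε : Fin n → S) (j : Fin n) :
    Odd (signedWord σ ε j) := by
  rcases Int.units_eq_one_or (ε j) with h | h
  · simp [signedWord, h]
  · rw [signedWord, h, Units.val_neg, Units.val_one, neg_one_mul]
    exact (odd_two_mul_add_one _).neg

theorem signedWord_injective (σ : Equiv.Perm (Fin n)) (ε : Fin n → S) :
    Function.Injective (signedWord σ ε) := by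
  intro j k h
  have hσ : (σ j : ℕ) = σ k := by
    have := congrArg Int.natAbs h
    simp only [signedWord, Int.natAbs_mul, Int.units_natAbs, one_mul] at this
    omega
  exact σ.injective (Fin.ext hσ)

theorem cons_signedWord_injective (k : ℕ) (σ : Equiv.Perm (Fin n)) (ε : Fin n → S) :
    Function.Injective (Fin.cons (2 * k) (signedWord σ ε) : Fin (n + 1) → ℤ) := by
  refine Fin.cons_injective_iff.2 ⟨?_, signedWord_injective σ ε⟩
  rintro ⟨j, hj⟩
  have := odd_signedWord σ ε j
  rw [hj] at this
  simp [← Int.not_even_iff_odd] at this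

theorem signedWord_zero_eq_iff (σ : Equiv.Perm (Fin (n + 1))) (ε : Fin (n + 1) → S)
    (k : Fin (n + 1)) : signedWord σ ε 0 = 2 * (k : ℕ) + 1 ↔ σ 0 = k ∧ ε 0 = 1 := by
  rw [signedWord, Fin.ext_iff, Subtype.ext_iff]
  rcases Int.units_eq_one_or (ε 0) with h | h
  · simp [h]
  · simp only [h, Units.val_neg, Units.val_one, neg_one_mul]
    exact iff_of_false (by omega) (by simp)

/-- The strictly increasing map inserting the letter `2 * k + 1` at the place of the separator
`2 * k`: it moves the larger letters up and the letters below `-2 * k` down. -/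
def openGap (k m : ℤ) : ℤ :=
  if m < -(2 * k) then m - 2 else if m < 2 * k then m else if m = 2 * k then m + 1 else m + 2

theorem openGap_strictMono (k : ℤ) : StrictMono (openGap k) := by
  intro a b hab
  unfold openGap
  split_ifs <;> omega

theorem signedWord_consPerm (k : Fin (n + 1)) (τ : Equiv.Perm (Fin n)) (δ : Fin n → S) :
    signedWord (consPerm k τ) (Fin.cons 1 δ : Fin (n + 1) → S) =
      openGap k ∘ (Fin.cons (2 * (k : ℕ)) (signedWord τ δ) : Fin (n + 1) → ℤ) := by
  funext j
  refine Fin.cases ?_ (fun j => ?_) j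
  · simp [signedWord, consPerm_zero, openGap]
  · have hsucc : ((k.succAbove (τ j) : Fin (n + 1)) : ℕ) =
        if (τ j : ℕ) < k then (τ j : ℕ) else τ j + 1 := by
      simp only [Fin.succAbove, Fin.lt_def, Fin.val_castSucc]
      split_ifs <;> simp
    simp only [signedWord, consPerm_succ, hsucc, Function.comp_apply, Fin.cons_succ, openGap]
    rcases Int.units_eq_one_or (δ j) with h | h <;>
      simp only [h, Units.val_neg, Units.val_one, neg_one_mul, one_mul] <;>
      split_ifs <;> omega

end SignedWords

section Entringer

variable {R : Type*} [CommRing R] (x : R)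

theorem stepWeight_two_mul_add_two (i : ℕ) (k : ℤ) {b : ℤ} (hb : Odd b) :
    stepWeight x i (2 * k + 2) b =
      stepWeight x i (2 * k) b + if b = 2 * k + 1 then (-1) ^ i * (1 - x) else 0 := by
  obtain ⟨m, rfl⟩ := hb
  unfold stepWeight
  rw [descentWeight_eq_add x i]
  split_ifs <;> first | omega | ring

variable (S : Subgroup ℤˣ) [Fintype S]

/-- The alternating Entringer polynomials, evaluated at `x`: the total weight of the permutations of
`n` letters with signs in `S`, preceded at position `i` by a letter that exceeds exactly `k` of the
`n` positive letters, and all negative ones. -/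
def altEntringer (n k i : ℕ) : R :=
  ∑ σ : Equiv.Perm (Fin n), ∑ ε : Fin n → S,
    wordWeight x i (Fin.cons (2 * (k : ℤ)) (signedWord σ ε) : Fin (n + 1) → ℤ)

theorem altEntringer_zero (k i : ℕ) : altEntringer x S 0 k i = 1 := by
  simp [altEntringer, wordWeight]

theorem altEntringer_succ (n k i : ℕ) :
    altEntringer x S (n + 1) k i = ∑ σ : Equiv.Perm (Fin (n + 1)), ∑ ε : Fin (n + 1) → S,
      stepWeight x i (2 * (k : ℤ)) (signedWord σ ε 0) * wordWeight x (i + 1) (signedWord σ ε) := by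
  simp only [altEntringer, wordWeight_cons]

theorem altEntringer_add_two (n k i : ℕ) :
    altEntringer x S n k (i + 2) = altEntringer x S n k i := by
  simp only [altEntringer, wordWeight_add_two]

theorem altEntringer_eq_sum_ite_first_letter {n k : ℕ} (hk : k ≤ n) (i : ℕ) :
    altEntringer x S n k i = ∑ σ : Equiv.Perm (Fin (n + 1)), ∑ ε : Fin (n + 1) → S,
      if signedWord σ ε 0 = 2 * k + 1 then wordWeight x i (signedWord σ ε) else 0 := by
  classical
  obtain ⟨k, rfl⟩ : ∃ l : Fin (n + 1), (l : ℕ) = k := ⟨⟨k, Nat.lt_succ_of_le hk⟩, rfl⟩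
  simp only [signedWord_zero_eq_iff, ite_and, Finset.sum_ite_irrel, Finset.sum_const_zero,
    sum_perm_ite_apply_zero, sum_fun_ite_apply_zero, signedWord_consPerm, altEntringer,
    wordWeight_comp_strictMono x i (openGap_strictMono _)]

theorem altEntringer_succ_succ {n k : ℕ} (hk : k ≤ n) (i : ℕ) :
    altEntringer x S (n + 1) (k + 1) i =
      altEntringer x S (n + 1) k i + (-1) ^ i * (1 - x) * altEntringer x S n k (i + 1) := by
  simp only [altEntringer_eq_sum_ite_first_letter x S hk, altEntringer_succ,
    Finset.mul_sum, ← Finset.sum_add_distrib]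
  refine Finset.sum_congr rfl fun σ _ => Finset.sum_congr rfl fun ε _ => ?_
  rw [Nat.cast_succ, mul_add, mul_one,
    stepWeight_two_mul_add_two x i k (odd_signedWord σ ε 0)]
  split_ifs <;> ring

/-- The evaluation at `x` of the alternating Eulerian polynomial of the permutations of `n + 1`
letters with signs in `S`, the first letter being at position `i`. -/
def signedEulerian (n i : ℕ) : R :=
  ∑ σ : Equiv.Perm (Fin (n + 1)), ∑ ε : Fin (n + 1) → S, wordWeight x i (signedWord σ ε)

theorem altEntringer_succ_self (n i : ℕ) :
    altEntringer x S (n + 1) (n + 1) i = descentWeight x i * signedEulerian x S n (i + 1) := by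
  simp only [altEntringer_succ, signedEulerian, Finset.mul_sum]
  refine Finset.sum_congr rfl fun σ _ => Finset.sum_congr rfl fun ε _ => ?_
  have hlt : signedWord σ ε 0 < 2 * ((n + 1 : ℕ) : ℤ) := by
    have := (σ 0).isLt
    rcases Int.units_eq_one_or (ε 0) with h | h <;>
      simp only [signedWord, h, Units.val_neg, Units.val_one, neg_one_mul, one_mul] <;>
      omega
  rw [stepWeight, if_pos hlt]

end Entringer

section Symmetry

variable {n : ℕ}

theorem signedWord_revPerm_mul (σ : Equiv.Perm (Fin n)) (ε : Fin n → (⊥ : Subgroup ℤˣ)) :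
    signedWord (Fin.revPerm * σ) ε = (fun m => 2 * (n : ℤ) - m) ∘ signedWord σ ε := by
  funext j
  have := (σ j).isLt
  have hε : (ε j : ℤˣ) = 1 := Subgroup.mem_bot.1 (ε j).2
  simp only [signedWord, hε, Equiv.Perm.mul_apply, Fin.revPerm_apply, Fin.val_rev, Units.val_one,
    one_mul, Function.comp_apply]
  omega

theorem signedWord_neg_mul {S : Subgroup ℤˣ} (hS : -1 ∈ S) (σ : Equiv.Perm (Fin n))
    (ε : Fin n → S) : signedWord σ ((fun _ => ⟨-1, hS⟩) * ε) = (fun m => -m) ∘ signedWord σ ε := by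
  funext j
  simp [signedWord]

theorem strictAnti_sub_left (c : ℤ) : StrictAnti fun m => c - m :=
  fun _ _ h => sub_lt_sub_left h c

variable {R : Type*} [CommRing R] (x : R) (S : Subgroup ℤˣ) [Fintype S]

theorem altEntringer_bot_reflect {k : ℕ} (hk : k ≤ n) (i : ℕ) :
    altEntringer x ⊥ n (n - k) (i + 1) = altEntringer x ⊥ n k i := by
  rw [altEntringer, ← Equiv.sum_comp (Equiv.mulLeft Fin.revPerm)]
  refine Finset.sum_congr rfl fun σ _ => Finset.sum_congr rfl fun ε _ => ?_
  rw [← wordWeight_comp_strictAnti x i (strictAnti_sub_left (2 * n))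
    (cons_signedWord_injective k σ ε), Equiv.coe_mulLeft, signedWord_revPerm_mul,
    Fin.comp_cons]
  congr
  push_cast [hk]
  ring

theorem altEntringer_zero_succ (hS : -1 ∈ S) (i : ℕ) :
    altEntringer x S n 0 (i + 1) = altEntringer x S n 0 i := by
  refine Finset.sum_congr rfl fun σ _ => ?_
  rw [← Equiv.sum_comp (Equiv.mulLeft fun _ => ⟨-1, hS⟩)]
  refine Finset.sum_congr rfl fun ε _ => ?_
  rw [← wordWeight_comp_strictAnti x i strictMono_id.neg (cons_signedWord_injective 0 σ ε)]
  simp [signedWord_neg_mul, Fin.comp_cons]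

theorem signedEulerian_bot_succ (i : ℕ) :
    signedEulerian x ⊥ n (i + 1) = signedEulerian x ⊥ n i := by
  rw [signedEulerian, ← Equiv.sum_comp (Equiv.mulLeft Fin.revPerm)]
  refine Finset.sum_congr rfl fun σ _ => Finset.sum_congr rfl fun ε _ => ?_
  rw [Equiv.coe_mulLeft, signedWord_revPerm_mul]
  exact wordWeight_comp_strictAnti x i (strictAnti_sub_left _) (signedWord_injective σ ε)

theorem signedEulerian_succ (hS : -1 ∈ S) (i : ℕ) :
    signedEulerian x S n (i + 1) = signedEulerian x S n i := by
  refine Finset.sum_congr rfl fun σ _ => ?_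
  rw [← Equiv.sum_comp (Equiv.mulLeft fun _ => ⟨-1, hS⟩)]
  refine Finset.sum_congr rfl fun ε _ => ?_
  rw [Equiv.coe_mulLeft, signedWord_neg_mul hS]
  exact wordWeight_comp_strictAnti x i strictMono_id.neg (signedWord_injective σ ε)

end Symmetry

section LetterCode

/-- The strictly increasing encoding of the letter `± (a + 1)` as `± (2 * a + 1)` used by
`signedWord`, with `0` encoded as `0`. -/
def letterCode (a : ℤ) : ℤ := 2 * a - a.sign

theorem letterCode_strictMono : StrictMono letterCode := by
  intro a b hab
  rcases lt_trichotomy a 0 with ha | rfl | ha <;> rcases lt_trichotomy b 0 with hb | rfl | hb <;>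
    simp only [letterCode, Int.sign_eq_one_of_pos, Int.sign_eq_neg_one_of_neg, Int.sign_zero, *] <;>
    omega

theorem signedWord_eq_letterCode_comp {n : ℕ} {S : Subgroup ℤˣ} (σ : Equiv.Perm (Fin n))
    (ε : Fin n → S) :
    signedWord σ ε = letterCode ∘ fun j => (ε j : ℤˣ) * (((σ j : ℕ) : ℤ) + 1) := by
  funext j
  have hsign : (((σ j : ℕ) : ℤ) + 1).sign = 1 := Int.sign_eq_one_of_pos (by omega)
  rw [Function.comp_apply, letterCode, Int.sign_mul, hsign, signedWord]
  rcases Int.units_eq_one_or (ε j) with h | h <;>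
    simp only [h, Units.val_neg, Units.val_one, neg_one_mul, one_mul, Int.sign_neg,
      Int.sign_one] <;>
    ring

end LetterCode

section TypeA

variable {R : Type*} [CommRing R] (x : R)

theorem pow_card_altDescentsA {n : ℕ} (σ : Equiv.Perm (Fin (n + 1)))
    (ε : Fin (n + 1) → (⊥ : Subgroup ℤˣ)) :
    x ^ (altDescentsA σ).card = wordWeight x 1 (signedWord σ ε) := by
  have hword (j : Fin (n + 1)) : wordA σ (1 + j) = (ε j : ℤˣ) * ((σ j : ℕ) + 1) := by
    have hj : 1 ≤ 1 + (j : ℕ) ∧ 1 + (j : ℕ) ≤ n + 1 := by omega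
    simp [wordA, hj, Subgroup.mem_bot.1 (ε j).2]
  have hIco : altDescentsA σ = (Finset.Ico 1 (1 + n)).filter (IsAltDescent (wordA σ)) := by
    simp only [altDescentsA, add_comm n 1]
  have hinj := signedWord_injective σ ε
  rw [signedWord_eq_letterCode_comp] at hinj ⊢
  rw [wordWeight_comp_strictMono x 1 letterCode_strictMono,
    ← pow_card_filter_isAltDescent x hword hinj.of_comp, hIco]

theorem aeval_altEulerianA_succ (n : ℕ) :
    Polynomial.aeval x (altEulerianA (n + 1)) = signedEulerian x ⊥ n 1 := by
  simp [altEulerianA, signedEulerian, pow_card_altDescentsA x _ default]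

end TypeA

section TypeB

variable {n : ℕ}

/-- The letter `s * (j + 1)` of `[±n]`. -/
def signedLetter (p : Fin n × ℤˣ) : PlusMinus n :=
  ⟨p.2 * ((p.1 : ℕ) + 1), by rcases Int.units_eq_one_or p.2 with h | h <;> simp [h] <;> omega⟩

theorem signedLetter_injective : Function.Injective (signedLetter (n := n)) := by
  intro p q h
  have hval : (p.2 : ℤ) * ((p.1 : ℕ) + 1) = q.2 * ((q.1 : ℕ) + 1) := congrArg Subtype.val h
  rcases Int.units_eq_one_or p.2 with hp | hp <;> rcases Int.units_eq_one_or q.2 with hq | hq <;>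
    simp only [hp, hq, Units.val_neg, Units.val_one, neg_one_mul, one_mul] at hval <;>
    first | omega | exact Prod.ext (Fin.ext (by omega)) (hp.trans hq.symm)

theorem signedLetter_surjective : Function.Surjective (signedLetter (n := n)) := by
  rintro ⟨a, ha⟩
  obtain ⟨hne, hlower, hupper⟩ : a ≠ 0 ∧ -(n : ℤ) ≤ a ∧ a ≤ n := by simpa using ha
  rcases hne.lt_or_gt with h | h
  · exact ⟨(⟨a.natAbs - 1, by omega⟩, -1), Subtype.ext (by simp [signedLetter]; omega)⟩
  · exact ⟨(⟨a.natAbs - 1, by omega⟩, 1), Subtype.ext (by simp [signedLetter]; omega)⟩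

/-- The bijection `signedLetter`, by which permutations of `[±n]` become permutations of
`Fin n × ℤˣ`. -/
noncomputable def plusMinusEquiv (n : ℕ) : Fin n × ℤˣ ≃ PlusMinus n :=
  Equiv.ofBijective signedLetter ⟨signedLetter_injective, signedLetter_surjective⟩

theorem coe_plusMinusEquiv (p : Fin n × ℤˣ) :
    (plusMinusEquiv n p : ℤ) = p.2 * ((p.1 : ℕ) + 1) := rfl

theorem coe_plusMinusEquiv_eq_neg_iff {p q : Fin n × ℤˣ} :
    (plusMinusEquiv n q : ℤ) = -(plusMinusEquiv n p : ℤ) ↔ q = (p.1, -p.2) := by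
  rw [← (plusMinusEquiv n).injective.eq_iff, Subtype.ext_iff]
  simp [coe_plusMinusEquiv]

/-- The type B permutation sending `j + 1` to `ε j * (τ j + 1)`. -/
noncomputable def signedPermOf (τ : Equiv.Perm (Fin n)) (ε : Fin n → (⊤ : Subgroup ℤˣ)) :
    SignedPerm n :=
  ⟨(plusMinusEquiv n).permCongr (Equiv.prodShear τ fun j => Equiv.mulRight (ε j : ℤˣ)), by
    intro i j hij
    obtain ⟨p, rfl⟩ := (plusMinusEquiv n).surjective i
    obtain ⟨q, rfl⟩ := (plusMinusEquiv n).surjective j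
    obtain rfl := coe_plusMinusEquiv_eq_neg_iff.1 hij
    simp [coe_plusMinusEquiv]⟩

theorem signedPermOf_apply (τ : Equiv.Perm (Fin n)) (ε : Fin n → (⊤ : Subgroup ℤˣ))
    (p : Fin n × ℤˣ) : (signedPermOf τ ε).1 (plusMinusEquiv n p) =
      plusMinusEquiv n (τ p.1, p.2 * ε p.1) := by
  simp [signedPermOf]

theorem exists_signedPermOf_eq (σ : SignedPerm n) : ∃ τ ε, signedPermOf τ ε = σ := by
  let f : Equiv.Perm (Fin n × ℤˣ) := (plusMinusEquiv n).symm.permCongr σ.1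
  have hf (p : Fin n × ℤˣ) : plusMinusEquiv n (f p) = σ.1 (plusMinusEquiv n p) := by simp [f]
  have hneg (p : Fin n × ℤˣ) : f (p.1, -p.2) = ((f p).1, -(f p).2) := by
    rw [← coe_plusMinusEquiv_eq_neg_iff, hf, hf]
    exact σ.2 _ _ (coe_plusMinusEquiv_eq_neg_iff.2 rfl)
  have hmul (j : Fin n) (s : ℤˣ) : f (j, s) = ((f (j, 1)).1, s * (f (j, 1)).2) := by
    rcases Int.units_eq_one_or s with rfl | rfl
    · simp
    · simpa using hneg (j, 1)
  have hinj : Function.Injective fun j => (f (j, 1)).1 := by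
    intro j k h
    have hjk : f (j, (f (j, 1)).2) = f (k, (f (k, 1)).2) := by
      rw [hmul j, hmul k, Int.units_mul_self, Int.units_mul_self]
      exact congrArg (·, 1) h
    exact congrArg Prod.fst (f.injective hjk)
  refine ⟨Equiv.ofBijective _ (Finite.injective_iff_bijective.1 hinj),
    fun j => ⟨(f (j, 1)).2, Subgroup.mem_top _⟩, Subtype.ext (Equiv.ext fun a => ?_)⟩
  obtain ⟨p, rfl⟩ := (plusMinusEquiv n).surjective a
  rw [signedPermOf_apply, ← hf, hmul p.1 p.2]
  rfl

theorem signedPermOf_bijective :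
    Function.Bijective fun p : Equiv.Perm (Fin n) × (Fin n → (⊤ : Subgroup ℤˣ)) =>
      signedPermOf p.1 p.2 := by
  refine ⟨fun p q h => ?_, fun σ => ?_⟩
  · have happly (j : Fin n) : (p.1 j, (p.2 j : ℤˣ)) = (q.1 j, (q.2 j : ℤˣ)) := by
      have := congrArg (fun σ : SignedPerm n => σ.1 (plusMinusEquiv n (j, 1))) h
      simpa [signedPermOf_apply] using this
    exact Prod.ext (Equiv.ext fun j => congrArg Prod.fst (happly j))
      (funext fun j => Subtype.ext (congrArg Prod.snd (happly j)))
  · obtain ⟨τ, ε, rfl⟩ := exists_signedPermOf_eq σ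
    exact ⟨(τ, ε), rfl⟩

theorem wordB_signedPermOf (τ : Equiv.Perm (Fin n)) (ε : Fin n → (⊤ : Subgroup ℤˣ))
    (j : Fin (n + 1)) : wordB (signedPermOf τ ε) j =
      (Fin.cons 0 fun j => (ε j : ℤˣ) * ((τ j : ℕ) + 1) : Fin (n + 1) → ℤ) j := by
  refine Fin.cases ?_ (fun j => ?_) j
  · simp [wordB]
  · have hj : ((j.succ : ℕ) : ℤ) = plusMinusEquiv n (j, 1) := by simp [coe_plusMinusEquiv]
    simp only [wordB, hj]
    rw [dif_pos (plusMinusEquiv n (j, 1)).2, Subtype.coe_eta, signedPermOf_apply,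
      coe_plusMinusEquiv, one_mul, Fin.cons_succ]

variable {R : Type*} [CommRing R] (x : R)

theorem pow_card_altDescentsB (τ : Equiv.Perm (Fin n)) (ε : Fin n → (⊤ : Subgroup ℤˣ)) :
    x ^ (altDescentsB (signedPermOf τ ε)).card =
      wordWeight x 0 (Fin.cons (2 * ((0 : ℕ) : ℤ)) (signedWord τ ε) : Fin (n + 1) → ℤ) := by
  have hcode : (Fin.cons (2 * ((0 : ℕ) : ℤ)) (signedWord τ ε) : Fin (n + 1) → ℤ) =
      letterCode ∘ Fin.cons 0 fun j => (ε j : ℤˣ) * (((τ j : ℕ) : ℤ) + 1) := by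
    rw [Fin.comp_cons, signedWord_eq_letterCode_comp]
    rfl
  have hinj := cons_signedWord_injective 0 τ ε
  rw [hcode] at hinj ⊢
  rw [wordWeight_comp_strictMono x 0 letterCode_strictMono,
    ← pow_card_filter_isAltDescent x (m := 0)
      (fun j => by simpa using wordB_signedPermOf τ ε j) hinj.of_comp,
    altDescentsB, zero_add, Finset.range_eq_Ico]

theorem aeval_altEulerianB [Fintype (⊤ : Subgroup ℤˣ)] (n : ℕ) :
    Polynomial.aeval x (altEulerianB n) = altEntringer x ⊤ n 0 0 := by
  simp only [altEulerianB, map_sum, map_pow, Polynomial.aeval_X, altEntringer,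
    ← pow_card_altDescentsB]
  rw [← signedPermOf_bijective.sum_comp, Fintype.sum_prod_type]

end TypeB

section SeidelArrays

open Finset.HasAntidiagonal (antidiagonal mem_antidiagonal)

/-- The array `t n k i` satisfies the recurrence of the Seidel–Entringer–Arnold triangle with step
`y`. The index `i` matters only modulo 2: it records the sign with which the boustrophedon adds, so
that all rows can be read in the same direction. -/
structure IsSeidelArray {R : Type*} [CommRing R] (y : R) (t : ℕ → ℕ → ℕ → R) : Prop where
  add_two : ∀ n k i, t n k (i + 2) = t n k i
  step : ∀ {n k}, k ≤ n → ∀ i,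
    t (n + 1) (k + 1) i = t (n + 1) k i + (-1) ^ i * y * t n k (i + 1)

theorem newton_expansion {R : Type*} [Semiring R] {φ : ℕ → ℕ → ℕ → R}
    (hφ : ∀ i n k, k ≤ n → φ i (n + 1) (k + 1) = φ i (n + 1) k + φ (i + 1) n k)
    {n k : ℕ} (hk : k ≤ n) (i : ℕ) :
    φ i n k = ∑ p ∈ antidiagonal k, (k.choose p.1 : R) * φ (i + p.1) (n - p.1) 0 := by
  induction k generalizing n i with
  | zero => simp
  | succ k ih =>
    obtain ⟨n, rfl⟩ : ∃ m, n = m + 1 := ⟨n - 1, by omega⟩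
    rw [hφ i n k (by omega), ih (by omega), ih (by omega),
      Finset.sum_antidiagonal_choose_succ_mul (fun p _ => φ (i + p) (n + 1 - p) 0)]
    congr 1
    refine Finset.sum_congr rfl fun p hp => ?_
    rw [Nat.choose_symm_of_eq_add (mem_antidiagonal.1 hp).symm, Nat.succ_sub_succ,
      add_assoc i 1, add_comm 1]

namespace IsSeidelArray

variable {R : Type*} [CommRing R] {y : R} {t : ℕ → ℕ → ℕ → R}

theorem shift (ht : IsSeidelArray y t) : IsSeidelArray (-y) fun n k i => t n k (i + 1) where
  add_two n k i := ht.add_two n k (i + 1)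
  step hk i := by rw [ht.step hk (i + 1)]; ring

theorem apply_two_mul (ht : IsSeidelArray y t) (n k m : ℕ) : t n k (2 * m) = t n k 0 := by
  induction m with
  | zero => rfl
  | succ m ih => rw [mul_add, mul_one, ht.add_two, ih]

theorem diagonal_eq_sum (ht : IsSeidelArray y t) (n : ℕ) :
    t n n 0 = ∑ p ∈ antidiagonal n,
      (n.choose p.1 : R) * ((-1) ^ (p.1 / 2) * y ^ p.1 * t p.2 0 p.1) := by
  have hstep (i n k : ℕ) (hk : k ≤ n) :
      (-1) ^ (i / 2) * y ^ i * t (n + 1) (k + 1) i = (-1) ^ (i / 2) * y ^ i * t (n + 1) k i +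
        (-1) ^ ((i + 1) / 2) * y ^ (i + 1) * t n k (i + 1) := by
    have hsign : (-1 : R) ^ ((i + 1) / 2) = (-1) ^ (i / 2) * (-1) ^ i := by
      obtain ⟨m, rfl | rfl⟩ := Nat.even_or_odd' i
      · rw [show (2 * m + 1) / 2 = 2 * m / 2 by omega, (even_two_mul m).neg_one_pow, mul_one]
      · rw [show (2 * m + 1 + 1) / 2 = (2 * m + 1) / 2 + 1 by omega, pow_succ,
          (odd_two_mul_add_one m).neg_one_pow]
    rw [ht.step hk, hsign]
    ring
  have h := newton_expansion (φ := fun i n k => (-1) ^ (i / 2) * y ^ i * t n k i) hstep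
    (le_refl n) 0
  simp only [Nat.zero_div, pow_zero, one_mul, zero_add] at h
  rw [h]
  refine Finset.sum_congr rfl fun p hp => ?_
  rw [← mem_antidiagonal.1 hp, Nat.add_sub_cancel_left]

end IsSeidelArray

end SeidelArrays

section ExponentialGeneratingFunctions

open Finset.HasAntidiagonal (antidiagonal mem_antidiagonal)

variable {K : Type*} [Field K]

/-- The exponential generating function of a sequence. -/
noncomputable def egf (a : ℕ → K) : PowerSeries K := PowerSeries.mk fun n => a n / n.factorial

theorem egf_eq_one_add {a b : ℕ → K} {x : K} (ha : a 0 = 1) (hb : b 0 = 1)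
    (h : ∀ n, a (n + 1) = x * b (n + 1)) :
    egf a = 1 + PowerSeries.C x * (egf b - 1) := by
  ext n
  cases n with
  | zero => simp [egf, ha, hb]
  | succ n => simp [egf, h, PowerSeries.coeff_one, mul_div_assoc]

variable [CharZero K]

theorem egf_mul_egf (a b : ℕ → K) :
    egf a * egf b = egf fun n => ∑ p ∈ antidiagonal n, n.choose p.1 * (a p.1 * b p.2) := by
  ext n
  rw [PowerSeries.coeff_mul, egf, egf, egf, PowerSeries.coeff_mk, Finset.sum_div]
  refine Finset.sum_congr rfl fun p hp => ?_
  have hfactorial (m : ℕ) : (m.factorial : K) ≠ 0 := Nat.cast_ne_zero.2 m.factorial_ne_zero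
  rw [← mem_antidiagonal.1 hp, Nat.cast_add_choose, PowerSeries.coeff_mk,
    PowerSeries.coeff_mk]
  field_simp [hfactorial]

theorem rescale_cos_eq_egf (y : K) :
    PowerSeries.rescale y (PowerSeries.cos K) =
      egf fun n => if Even n then (-1) ^ (n / 2) * y ^ n else 0 := by
  ext n
  simp only [PowerSeries.coeff_rescale, PowerSeries.cos, egf, PowerSeries.coeff_mk, ite_div]
  split_ifs
  · simp; ring
  · simp

theorem rescale_sin_eq_egf (y : K) :
    PowerSeries.rescale y (PowerSeries.sin K) =
      egf fun n => if Even n then 0 else (-1) ^ (n / 2) * y ^ n := by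
  ext n
  simp only [PowerSeries.coeff_rescale, PowerSeries.sin, egf, PowerSeries.coeff_mk, ite_div]
  split_ifs
  · simp
  · simp; ring

theorem rescale_neg_cos (y : K) :
    PowerSeries.rescale (-y) (PowerSeries.cos K) = PowerSeries.rescale y (PowerSeries.cos K) := by
  simp only [rescale_cos_eq_egf]
  congr 2 with n
  split_ifs with h
  · rw [h.neg_pow]
  · rfl

theorem rescale_neg_sin (y : K) :
    PowerSeries.rescale (-y) (PowerSeries.sin K) = -PowerSeries.rescale y (PowerSeries.sin K) := by
  ext n
  simp only [rescale_sin_eq_egf, egf, PowerSeries.coeff_mk, map_neg]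
  split_ifs with h
  · simp
  · rw [(Nat.not_even_iff_odd.1 h).neg_pow, mul_neg, neg_div]

namespace IsSeidelArray

variable {y : K} {t : ℕ → ℕ → ℕ → K}

theorem egf_diagonal (ht : IsSeidelArray y t) :
    egf (fun n => t n n 0) =
      PowerSeries.rescale y (PowerSeries.cos K) * egf (fun n => t n 0 0) +
        PowerSeries.rescale y (PowerSeries.sin K) * egf (fun n => t n 0 1) := by
  rw [rescale_cos_eq_egf, rescale_sin_eq_egf, egf_mul_egf, egf_mul_egf]
  ext n
  simp only [egf, map_add, PowerSeries.coeff_mk, ← add_div, ← Finset.sum_add_distrib,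
    ht.diagonal_eq_sum]
  congr 1
  refine Finset.sum_congr rfl fun p _ => ?_
  obtain ⟨m, hm | hm⟩ := Nat.even_or_odd' p.1
  · simp [hm, ht.apply_two_mul]
  · simp [hm, ht.shift.apply_two_mul]

theorem egf_diagonal_one (ht : IsSeidelArray y t) :
    egf (fun n => t n n 1) =
      PowerSeries.rescale y (PowerSeries.cos K) * egf (fun n => t n 0 1) -
        PowerSeries.rescale y (PowerSeries.sin K) * egf (fun n => t n 0 0) := by
  simpa only [rescale_neg_cos, rescale_neg_sin, zero_add, ht.add_two, neg_mul, ← sub_eq_add_neg]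
    using ht.shift.egf_diagonal

end IsSeidelArray

end ExponentialGeneratingFunctions

section AlternatingEulerian

theorem isSeidelArray_altEntringer {R : Type*} [CommRing R] (x : R) (S : Subgroup ℤˣ)
    [Fintype S] : IsSeidelArray (1 - x) (altEntringer x S) where
  add_two := altEntringer_add_two x S
  step := altEntringer_succ_succ x S

variable {K : Type*} [Field K] (x : K)

theorem egf_altEntringer_diagonal_one {S : Subgroup ℤˣ} [Fintype S]
    (hS : ∀ n, signedEulerian x S n 2 = signedEulerian x S n 1) :
    egf (fun n => altEntringer x S n n 1) =
      1 + PowerSeries.C x * (egf (fun n => altEntringer x S n n 0) - 1) :=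
  egf_eq_one_add (altEntringer_zero x S 0 1) (altEntringer_zero x S 0 0) fun n => by
    simp [altEntringer_succ_self, hS, descentWeight]

variable [CharZero K]

theorem egf_altEntringer_bot_diagonal :
    egf (fun n => altEntringer x ⊥ n n 0) = secTan x * egf (fun n => altEntringer x ⊥ n n 1) := by
  have hdiag := (isSeidelArray_altEntringer x ⊥).egf_diagonal_one
  have hedge (n : ℕ) : altEntringer x ⊥ n 0 1 = altEntringer x ⊥ n n 0 := by
    simpa using altEntringer_bot_reflect x (le_refl n) 0
  have hcorner (n : ℕ) : altEntringer x ⊥ n 0 0 = altEntringer x ⊥ n n 1 := by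
    simpa using (altEntringer_bot_reflect x (Nat.zero_le n) 0).symm
  simp only [hedge, hcorner] at hdiag
  have hsec : PowerSeries.rescale (1 - x) (PowerSeries.cos K) *
      PowerSeries.rescale (1 - x) (secSeries K) = 1 := by
    rw [← map_mul, cos_mul_secSeries, map_one]
  have htan : PowerSeries.rescale (1 - x) (tanSeries K) =
      PowerSeries.rescale (1 - x) (PowerSeries.sin K) *
        PowerSeries.rescale (1 - x) (secSeries K) := map_mul _ _ _
  rw [secTan, htan]
  linear_combination (-PowerSeries.rescale (1 - x) (secSeries K)) * hdiag -
    egf (fun n => altEntringer x ⊥ n n 0) * hsec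

theorem egf_altEntringer_bot_sub_one_mul_denomA :
    (egf (fun n => altEntringer x ⊥ n n 0) - 1) * denomA x = secTan x - 1 := by
  have hsecTan := egf_altEntringer_bot_diagonal x
  rw [egf_altEntringer_diagonal_one x fun _ => signedEulerian_bot_succ x 1] at hsecTan
  rw [denomA]
  linear_combination hsecTan

theorem egf_altEntringer_mul_denomB {S : Subgroup ℤˣ} [Fintype S] (hS : -1 ∈ S) :
    egf (fun n => altEntringer x S n 0 0) * denomB x = PowerSeries.C (x - 1) := by
  have hseidel := isSeidelArray_altEntringer x S
  have hdiag := egf_altEntringer_diagonal_one x fun _ => signedEulerian_succ x S hS 1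
  rw [hseidel.egf_diagonal, hseidel.egf_diagonal_one] at hdiag
  simp only [altEntringer_zero_succ x S hS 0] at hdiag
  rw [denomB, map_sub, map_add, map_one]
  linear_combination -hdiag

end AlternatingEulerian

theorem theorem3 {K : Type*} [Field K] [CharZero K] (x : K) (hx : x ≠ 1) :
    (PowerSeries.mk (fun n : ℕ =>
        if 0 < n then Polynomial.aeval x (altEulerianA n) / (n.factorial : K) else 0) =
      (secTan x - 1) * (denomA x)⁻¹) ∧
    (PowerSeries.mk (fun n : ℕ => Polynomial.aeval x (altEulerianB n) / (n.factorial : K)) =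
      PowerSeries.C (x - 1) * (denomB x)⁻¹) := by
  constructor
  · have h : PowerSeries.mk (fun n : ℕ =>
        if 0 < n then Polynomial.aeval x (altEulerianA n) / (n.factorial : K) else 0) =
        egf (fun n => altEntringer x ⊥ n n 0) - 1 := by
      ext n
      cases n with
      | zero => simp [egf, altEntringer_zero]
      | succ n =>
        simp [egf, PowerSeries.coeff_one, aeval_altEulerianA_succ, altEntringer_succ_self,
          descentWeight]
    rw [h, ← egf_altEntringer_bot_sub_one_mul_denomA, mul_assoc, denomA_mul_inv x hx, mul_one]
  · classical
    simp only [aeval_altEulerianB]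
    rw [← egf_altEntringer_mul_denomB x (Subgroup.mem_top _), mul_assoc, denomB_mul_inv x hx,
      mul_one]
    rfl
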